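/- For $x\in[-1,1]$ write $x=\frac{x_0}{2}+\frac{x_1}{2^2}+\frac{x_2}{2^3}+\cdots$ with $x_n\in\{-1,+1\}$ (the expansion is unique for all but countably many $x$; at the others one of the two is fixed). For $0\le n\le m$ let $L_{nm}(x)=1$ if $\sum_{j=n}^m x_j=0$ and $L_{nm}(x)=0$ otherwise, and for a complex number $\lambda$ with $|\lambda|<1$ let $$U(x)=\sum_{0\le n\le m<\infty}\lambda^{m+1}L_{nm}(x).$$ Let $A,B,N\ge 0$ and $c$ be integers with $|c|<2^N$. Then there are polynomials $P,Q$ in $\lambda,z_1,\dots,z_B$ with integer coefficients, depending only on $A,B,N,c$ and constructed explicitly below, such that the following holds. (1) $Q=a(\lambda)\,z_1^{e_1}\cdots z_B^{e_B}\prod_{k}q_k$ for some polynomial $a$ with integer coefficients, some integers $e_i\ge0$ and finitely many polynomials $q_k$ of the form $$\lambda^m\prod_{i\in\alpha}z_i^2-2^{n+1}\prod_{i\in\alpha}z_i+\lambda^m,\qquad \alpha\subset\{1,\dots,B\},\ 0\le n\le A,\ 0\le m\le B .$$ (2) For every complex $\lambda$ with $|\lambda|<1$, $Q(\lambda,z_1,\dots,z_B)\neq0$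 whenever $|z_1|=\dots=|z_B|=1$, the function $x^AU(x)^B$ is integrable on $[\frac{c-1}{2^N},\frac{c+1}{2^N}]$, and $$\int_{\frac{c-1}{2^N}}^{\frac{c+1}{2^N}}x^AU(x)^B\,dx=\frac1{(2\pi i)^B}\oint_{|z_1|=1}\cdots\oint_{|z_B|=1}\frac{P(\lambda,z_1,\dots,z_B)}{Q(\lambda,z_1,\dots,z_B)}\,dz_B\cdots dz_1 .$$ Construction of $P$ and $Q$. Let $\mathcal S$ be the set of pairs $p=(n,s)$ with $0\le n\le A$ and $s\in\{0,1,2\}^B$, and let $o=(0,(0,\dots,0))$. For $\sigma=\pm1$ let $T_\sigma$ be the $\mathcal S\times\mathcal S$ matrix whose entry at $(n,s),(n',s')$ is $$2^{A-n}\binom{n}{n'}\sigma^{n-n'}\lambda^{\#\{i:\,s'_i\ne0\}}\prod_{i:\,s'_i=1}z_i^{1+\sigma}\prod_{i:\,s'_i\neq1}z_i$$ if $n'\le n$ and $s'_i\in\{s_i,s_i-1\}$ for all $i$, and $0$ otherwise. Put $D=2^{A+1}z_1\cdots z_B$, let $M$ be the matrix $D\cdot I-T_{+1}-T_{-1}$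 with its row $o$ replaced by the row $o$ of the identity matrix, and let $b$ be the vector with $b_o=2$ and all other entries $0$. For $0\le t<2^{N+1}$ with binary digits $t=\sum_{j=0}^{N}\beta_j2^{N-j}$ let $W_t=T_{2\beta_0-1}T_{2\beta_1-1}\cdots T_{2\beta_N-1}$. Then $$Q=\det(M)\,D^{N+1}\,z_1\cdots z_B$$ and $P$ is the entry at $(A,(2,\dots,2))$ of the vector $(W_{c+2^N-1}+W_{c+2^N})\,\operatorname{adj}(M)\,b$. -/

import Mathlib

open MeasureTheory

/-! ### Sign expansions and the loop counting function -/

/-- The remainders of the greedy expansion of `x` with digits `±1`: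
`x = x₀/2 + ⋯ + x_{n-1}/2^n + signRemainder x n / 2^n`. -/
noncomputable def signRemainder (x : ℝ) : ℕ → ℝ
  | 0 => x
  | n + 1 => 2 * signRemainder x n - (if 0 ≤ signRemainder x n then 1 else -1)

/-- The digit `x_n ∈ {-1, 1}` in `x = x₀/2 + x₁/2² + x₂/2³ + ⋯`. All but countably many
`x ∈ [-1, 1]` have only one such expansion; at the others this selects one of the two. -/
noncomputable def signDigit (x : ℝ) (n : ℕ) : ℤ :=
  if 0 ≤ signRemainder x n then 1 else -1

theorem signRemainder_mem {x : ℝ} (hx : x ∈ Set.Icc (-1 : ℝ) 1) (n : ℕ) :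
    signRemainder x n ∈ Set.Icc (-1 : ℝ) 1 := by
  induction n with
  | zero => exact hx
  | succ n ih =>
    obtain ⟨h1, h2⟩ := ih
    simp only [signRemainder]
    split_ifs with h
    · constructor <;> linarith
    · constructor <;> linarith

theorem signRemainder_eq (x : ℝ) (n : ℕ) :
    x = ∑ j ∈ Finset.range n, (signDigit x j : ℝ) / 2 ^ (j + 1) + signRemainder x n / 2 ^ n := by
  induction n with
  | zero => simp [signRemainder]
  | succ n ih =>
    rw [Finset.sum_range_succ]
    have h : signRemainder x (n + 1) = 2 * signRemainder x n - (signDigit x n : ℝ) := by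
      simp only [signRemainder, signDigit]
      split_ifs <;> simp
    rw [h]
    have h2 : (2 : ℝ) ^ (n + 1) = 2 * 2 ^ n := pow_succ' 2 n
    have h3 : (2 : ℝ) ^ n ≠ 0 := by positivity
    conv_lhs => rw [ih]
    rw [h2]
    field_simp
    ring

/-- The digits do expand `x`. -/
theorem hasSum_signDigit {x : ℝ} (hx : x ∈ Set.Icc (-1 : ℝ) 1) :
    HasSum (fun n => (signDigit x n : ℝ) / 2 ^ (n + 1)) x := by
  have hs : Summable (fun n => (signDigit x n : ℝ) / 2 ^ (n + 1)) := by
    refine Summable.of_norm_bounded (g := fun n : ℕ => (1 / 2 : ℝ) ^ n)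
      (summable_geometric_of_lt_one (by norm_num) (by norm_num)) fun n => ?_
    have h1 : ‖(signDigit x n : ℝ)‖ = 1 := by
      simp only [signDigit]
      split_ifs <;> simp
    rw [norm_div, h1, norm_pow, one_div_pow]
    have h2 : ‖(2 : ℝ)‖ = 2 := by simp
    rw [h2]
    exact one_div_le_one_div_of_le (by positivity)
      (pow_le_pow_right₀ (by norm_num) (Nat.le_succ n))
  have hr : Filter.Tendsto (fun n => signRemainder x n / 2 ^ n) Filter.atTop (nhds 0) := by
    refine squeeze_zero_norm (a := fun n : ℕ => (1 / 2 : ℝ) ^ n) (fun n => ?_)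
      (tendsto_pow_atTop_nhds_zero_of_lt_one (by norm_num) (by norm_num))
    have h1 : ‖signRemainder x n‖ ≤ 1 := abs_le.2 (signRemainder_mem hx n)
    rw [norm_div, norm_pow, one_div_pow]
    have h2 : ‖(2 : ℝ)‖ = 2 := by simp
    rw [h2]
    gcongr
  have ht : Filter.Tendsto (fun n => ∑ j ∈ Finset.range n, (signDigit x j : ℝ) / 2 ^ (j + 1))
      Filter.atTop (nhds x) := by
    have h := (tendsto_const_nhds (x := x)).sub hr
    rw [sub_zero] at h
    refine h.congr fun n => ?_
    have := signRemainder_eq x n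
    linarith
  exact (hs.hasSum_iff_tendsto_nat).2 ht

/-- `L_{nm}(x)`: the steps `x_n, …, x_m` form a loop. -/
noncomputable def loopIndicator (x : ℝ) (n m : ℕ) : ℂ :=
  if ∑ j ∈ Finset.Icc n m, signDigit x j = 0 then 1 else 0

/-- The loop counting function `U(x) = ∑_{0 ≤ n ≤ m} λ^{m+1} L_{nm}(x)`; the series converges
absolutely for `‖λ‖ < 1`. -/
noncomputable def loopU (lam : ℂ) (x : ℝ) : ℂ :=
  ∑' m : ℕ, ∑ n ∈ Finset.range (m + 1), lam ^ (m + 1) * loopIndicator x n m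

/-! ### Explicit construction of the two polynomials

Polynomials in `λ, z₁, …, z_B` with integer coefficients: the variable `none` is `λ` and the
variable `some i` is `z_i`. -/

/-- The value of a polynomial at `(λ, z₁, …, z_B)`. -/
noncomputable def evalLamZ {B : ℕ} (lam : ℂ) (z : Fin B → ℂ)
    (p : MvPolynomial (Option (Fin B)) ℤ) : ℂ :=
  MvPolynomial.aeval (fun o : Option (Fin B) => o.elim lam z) p

/-- Index set of the monomials `x^n y₁ ⋯ y_B` with `0 ≤ n ≤ A` and `y_i ∈ {1, F_i, G_i}`:
the value `0, 1, 2` of `s i` stands for `y_i = 1, F_i, G_i`. -/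
abbrev LoopState (A B : ℕ) : Type := Fin (A + 1) × (Fin B → Fin 3)

/-- The number of `i` with `y_i ≠ 1`. -/
def LoopState.weight {A B : ℕ} (q : LoopState A B) : ℕ :=
  (Finset.univ.filter fun i => q.2 i ≠ 0).card

/-- The matrix, in the monomials above, of `2^{A+1} z₁ ⋯ z_B / 2` times the substitution
`x ↦ (x ± 1)/2`, `F_i ↦ 1 + λ z_i^{±1} F_i`, `G_i ↦ λ G_i + λ z_i^{±1} F_i`,
with `+` for `up = true` and `-` for `up = false`. The row `p` expands the image of `p`. -/
noncomputable def stepMatrix (A B : ℕ) (up : Bool) :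
    Matrix (LoopState A B) (LoopState A B) (MvPolynomial (Option (Fin B)) ℤ) :=
  Matrix.of fun p q =>
    if q.1 ≤ p.1 ∧ ∀ i, (q.2 i : ℕ) = p.2 i ∨ (q.2 i : ℕ) + 1 = p.2 i then
      MvPolynomial.C ((2 : ℤ) ^ (A - (p.1 : ℕ)) * ((p.1 : ℕ).choose q.1 : ℤ) *
          (if up then (1 : ℤ) else -1) ^ ((p.1 : ℕ) - (q.1 : ℕ))) *
        MvPolynomial.X none ^ q.weight *
        ∏ i, MvPolynomial.X (some i) ^ (if q.2 i = 1 then (if up then 2 else 0) else 1)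
    else 0

/-- `2^{A+1} z₁ ⋯ z_B`. -/
noncomputable def stepScale (A B : ℕ) : MvPolynomial (Option (Fin B)) ℤ :=
  MvPolynomial.C ((2 : ℤ) ^ (A + 1)) * ∏ i, MvPolynomial.X (some i)

/-- The matrix of the linear system for the integrals over `[-1, 1]` of the monomials: the row of
the monomial `1` says that its integral is given, the others that the integral is
invariant under the mean of the two substitutions. -/
noncomputable def systemMatrix (A B : ℕ) :
    Matrix (LoopState A B) (LoopState A B) (MvPolynomial (Option (Fin B)) ℤ) :=
  Matrix.of fun p q =>
    if p = (0, fun _ => 0) then (if q = p then 1 else 0)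
    else (if q = p then stepScale A B else 0) - stepMatrix A B true p q - stepMatrix A B false p q

/-- The right-hand side of that system. -/
noncomputable def systemRhs (A B : ℕ) : LoopState A B → MvPolynomial (Option (Fin B)) ℤ :=
  fun p => if p = (0, fun _ => 0) then 2 else 0

/-- The product of the step matrices along the `M` binary digits of `t`, the most significant
first; it belongs to the interval `[-1 + 2t/2^M, -1 + 2(t+1)/2^M]`. -/
noncomputable def wordMatrix (A B : ℕ) :
    ℕ → ℕ → Matrix (LoopState A B) (LoopState A B) (MvPolynomial (Option (Fin B)) ℤ)
  | 0, _ => 1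
  | M + 1, t => wordMatrix A B M (t / 2) * stepMatrix A B (decide (t % 2 = 1))

/-- The numerator `P`: Cramer's rule for the linear system, transported to the two halves
`[(c-1)/2^N, c/2^N]` and `[c/2^N, (c+1)/2^N]` of the interval, at the monomial `x^A G₁ ⋯ G_B`. -/
noncomputable def loopP (A B N : ℕ) (c : ℤ) : MvPolynomial (Option (Fin B)) ℤ :=
  ((wordMatrix A B (N + 1) (c + 2 ^ N - 1).toNat + wordMatrix A B (N + 1) (c + 2 ^ N).toNat).mulVec
    ((systemMatrix A B).cramer (systemRhs A B))) (Fin.last A, fun _ => 2)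

/-- The denominator `Q`. -/
noncomputable def loopQ (A B N : ℕ) : MvPolynomial (Option (Fin B)) ℤ :=
  (systemMatrix A B).det * stepScale A B ^ (N + 1) * ∏ i, MvPolynomial.X (some i)

/-- The quadratic polynomial `λ^m ∏_{i∈α} z_i² - 2^{n+1} ∏_{i∈α} z_i + λ^m`. -/
noncomputable def loopQuadratic {B : ℕ} (α : Finset (Fin B)) (n m : ℕ) :
    MvPolynomial (Option (Fin B)) ℤ :=
  MvPolynomial.X none ^ m * ∏ i ∈ α, MvPolynomial.X (some i) ^ 2
    - MvPolynomial.C ((2 : ℤ) ^ (n + 1)) * ∏ i ∈ α, MvPolynomial.X (some i)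
    + MvPolynomial.X none ^ m

/-! For |z| = 1 put F(x) = ∑ λ^k z^{x_0+⋯+x_{k-1}} and G(x) = ∑_{n≤m} λ^{m+1} z^{x_n+⋯+x_m}. Then U
is the constant term of G in z, and U^B is the constant term of G_1⋯G_B in B independent variables.
By Fubini it suffices to integrate x^A G_1⋯G_B over x for fixed z; the measures dz_i/z_i account for
the last factor z_1⋯z_B of Q.

Splitting off the first step gives, for x = (y ± 1)/2, F(x) = 1 + λz^{±1}F(y) and G(x) = λG(y) +
λz^{±1}F(y) (`walkSeries_eq`, `loopSeries_eq`). Hence the monomials x^n y_1⋯y_B with y_i ∈ {1, F_i,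
G_i} span a finite-dimensional space stable under both substitutions (`stateMonomial_half`). Since
∫f over [-1,1] is the mean of the integrals of the two substituted functions, the integrals of the
monomials solve a linear system, and iterated substitution transports them to dyadic subintervals.

The system is triangular, because no substitution raises n or moves y_i up the chain 1, F, G. Its
determinant is therefore the product of the diagonal entries, which are the quadratics up to
constants and monomials (`systemMatrix_diag`). They do not vanish on the torus
(`eval_loopQuadratic_ne_zero`), so Cramer's rule gives P/Q. -/

/-! ### Digits, the shift and partial sums -/

theorem signRemainder_succ (x : ℝ) (n : ℕ) :
    signRemainder x (n + 1) = 2 * signRemainder x n - (signDigit x n : ℝ) := by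
  simp only [signRemainder, signDigit]
  split_ifs <;> simp

theorem signRemainder_signRemainder_one (x : ℝ) (n : ℕ) :
    signRemainder (signRemainder x 1) n = signRemainder x (n + 1) := by
  induction n with
  | zero => rfl
  | succ n ih => rw [signRemainder_succ _ n, signRemainder_succ x (n + 1), signDigit, signDigit, ih]

theorem signDigit_signRemainder_one (x : ℝ) (n : ℕ) :
    signDigit (signRemainder x 1) n = signDigit x (n + 1) := by
  rw [signDigit, signRemainder_signRemainder_one, signDigit]

theorem measurable_signRemainder (n : ℕ) : Measurable fun x => signRemainder x n := by
  induction n with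
  | zero => exact measurable_id
  | succ n ih =>
    simp only [signRemainder]
    exact (ih.const_mul 2).sub
      (Measurable.ite (measurableSet_le measurable_const ih) measurable_const measurable_const)

theorem measurable_signDigit (n : ℕ) : Measurable fun x => signDigit x n :=
  Measurable.ite (measurableSet_le measurable_const (measurable_signRemainder n))
    measurable_const measurable_const

/-- The sum of the digits `x_j` with `n ≤ j ≤ m`. -/
noncomputable def digitSum (n m : ℕ) (x : ℝ) : ℤ := ∑ j ∈ Finset.Icc n m, signDigit x j

theorem measurable_digitSum (n m : ℕ) : Measurable (digitSum n m) :=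
  Finset.measurable_sum _ fun j _ => measurable_signDigit j

theorem digitSum_succ_succ (n m : ℕ) (x : ℝ) :
    digitSum (n + 1) (m + 1) x = digitSum n m (signRemainder x 1) := by
  simp only [digitSum, signDigit_signRemainder_one]
  rw [← Finset.map_add_right_Icc n m 1, Finset.sum_map]
  rfl

theorem digitSum_zero_succ (m : ℕ) (x : ℝ) :
    digitSum 0 (m + 1) x = signDigit x 0 + digitSum 0 m (signRemainder x 1) := by
  rw [← digitSum_succ_succ]
  simp only [digitSum]
  rw [← Finset.insert_Icc_succ_left_eq_Icc (Nat.zero_le (m + 1)), Finset.sum_insert (by simp)]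
  rfl

/-! ### The generating functions F and G and their recursions -/

/-- The generating function `∑ λ^k z^{x₀ + ⋯ + x_{k-1}}` of the walk with steps `x_j`. -/
noncomputable def walkSeries (lam z : ℂ) (x : ℝ) : ℂ :=
  1 + ∑' m : ℕ, lam ^ (m + 1) * z ^ digitSum 0 m x

/-- The terms of `loopSeries`. -/
noncomputable def loopTerm (lam z : ℂ) (x : ℝ) (m : ℕ) : ℂ :=
  ∑ n ∈ Finset.range (m + 1), lam ^ (m + 1) * z ^ digitSum n m x

/-- The generating function `∑_{n ≤ m} λ^{m+1} z^{x_n + ⋯ + x_m}` of the increments of the walk. -/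
noncomputable def loopSeries (lam z : ℂ) (x : ℝ) : ℂ :=
  ∑' m : ℕ, loopTerm lam z x m

section
variable {lam z : ℂ}

theorem norm_walkTerm (hz : ‖z‖ = 1) (x : ℝ) (m : ℕ) :
    ‖lam ^ (m + 1) * z ^ digitSum 0 m x‖ = ‖lam‖ ^ (m + 1) := by
  simp [hz]

theorem norm_loopTerm_le (hz : ‖z‖ = 1) (x : ℝ) (m : ℕ) :
    ‖loopTerm lam z x m‖ ≤ (m + 1 : ℕ) * ‖lam‖ ^ (m + 1) := by
  refine (norm_sum_le _ _).trans (le_of_eq ?_)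
  simp [hz]

theorem summable_norm_pow_succ (h : ‖lam‖ < 1) : Summable fun m : ℕ => ‖lam‖ ^ (m + 1) :=
  (summable_nat_add_iff 1).2 (summable_geometric_of_lt_one (norm_nonneg _) h)

theorem summable_mul_norm_pow_succ (h : ‖lam‖ < 1) :
    Summable fun m : ℕ => ((m + 1 : ℕ) : ℝ) * ‖lam‖ ^ (m + 1) := by
  have := summable_pow_mul_geometric_of_norm_lt_one (R := ℝ) 1 (r := ‖lam‖) (by simpa using h)
  simp only [pow_one] at this
  exact (summable_nat_add_iff 1).2 this

theorem summable_walkTerm (h : ‖lam‖ < 1) (hz : ‖z‖ = 1) (x : ℝ) :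
    Summable fun m : ℕ => lam ^ (m + 1) * z ^ digitSum 0 m x :=
  Summable.of_norm_bounded (summable_norm_pow_succ h) fun m => (norm_walkTerm hz x m).le

theorem summable_loopTerm (h : ‖lam‖ < 1) (hz : ‖z‖ = 1) (x : ℝ) :
    Summable (loopTerm lam z x) :=
  Summable.of_norm_bounded (summable_mul_norm_pow_succ h) fun m => norm_loopTerm_le hz x m

theorem norm_walkSeries_le (h : ‖lam‖ < 1) (hz : ‖z‖ = 1) (x : ℝ) :
    ‖walkSeries lam z x‖ ≤ 1 + ∑' m : ℕ, ‖lam‖ ^ (m + 1) := by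
  refine (norm_add_le _ _).trans ?_
  rw [norm_one]
  gcongr
  exact tsum_of_norm_bounded (summable_norm_pow_succ h).hasSum fun m => (norm_walkTerm hz x m).le

theorem norm_loopSeries_le (h : ‖lam‖ < 1) (hz : ‖z‖ = 1) (x : ℝ) :
    ‖loopSeries lam z x‖ ≤ ∑' m : ℕ, ((m + 1 : ℕ) : ℝ) * ‖lam‖ ^ (m + 1) :=
  tsum_of_norm_bounded (summable_mul_norm_pow_succ h).hasSum fun m => norm_loopTerm_le hz x m

theorem walkSeries_eq (h : ‖lam‖ < 1) (hz : ‖z‖ = 1) (x : ℝ) :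
    walkSeries lam z x
      = 1 + lam * z ^ signDigit x 0 * walkSeries lam z (signRemainder x 1) := by
  have hz0 : z ≠ 0 := fun h0 => by simp [h0] at hz
  rw [walkSeries, (summable_walkTerm h hz x).tsum_eq_zero_add, walkSeries, mul_add, ← tsum_mul_left]
  congr 2
  · simp [digitSum]
  · refine tsum_congr fun m => ?_
    rw [digitSum_zero_succ, zpow_add₀ hz0]
    ring

theorem loopTerm_zero (x : ℝ) : loopTerm lam z x 0 = lam * z ^ signDigit x 0 := by
  simp [loopTerm, digitSum]

/-- Increments starting at n ≥ 1 are increments of the shifted walk; the one starting at n = 0 is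
the first step followed by an initial segment of that walk. -/
theorem loopTerm_succ (hz : ‖z‖ = 1) (x : ℝ) (m : ℕ) :
    loopTerm lam z x (m + 1) = lam * loopTerm lam z (signRemainder x 1) m
      + lam * z ^ signDigit x 0 * (lam ^ (m + 1) * z ^ digitSum 0 m (signRemainder x 1)) := by
  have hz0 : z ≠ 0 := fun h0 => by simp [h0] at hz
  rw [loopTerm, Finset.sum_range_succ', loopTerm, Finset.mul_sum]
  congr 1
  · refine Finset.sum_congr rfl fun n _ => ?_
    rw [digitSum_succ_succ]
    ring
  · rw [digitSum_zero_succ, zpow_add₀ hz0]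
    ring

theorem loopSeries_eq (h : ‖lam‖ < 1) (hz : ‖z‖ = 1) (x : ℝ) :
    loopSeries lam z x = lam * loopSeries lam z (signRemainder x 1)
      + lam * z ^ signDigit x 0 * walkSeries lam z (signRemainder x 1) := by
  rw [loopSeries, (summable_loopTerm h hz x).tsum_eq_zero_add, loopTerm_zero]
  simp only [loopTerm_succ hz]
  rw [Summable.tsum_add ((summable_loopTerm h hz _).mul_left _)
    ((summable_walkTerm h hz _).mul_left _), tsum_mul_left, tsum_mul_left, walkSeries, loopSeries]
  ring

end

/-! ### The substitution x = (y ± 1)/2 on monomials -/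

/-- The sign `1` or `-1`. -/
def boolSign (up : Bool) : ℤ := if up then 1 else -1

/-- The endpoint y = 1 is excluded because its lower image is x = 0, where the greedy digit is +1.
-/
theorem signDigit_half (up : Bool) {y : ℝ} (hy : y ∈ Set.Ico (-1 : ℝ) 1) :
    signDigit ((y + boolSign up) / 2) 0 = boolSign up := by
  obtain ⟨h1, h2⟩ := hy
  have h0 : signDigit ((y + boolSign up) / 2) 0
      = if 0 ≤ (y + boolSign up) / 2 then 1 else -1 := rfl
  rw [h0]
  cases up
  · rw [if_neg (by simp [boolSign]; linarith), boolSign, if_neg Bool.false_ne_true]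
  · rw [if_pos (by simp [boolSign]; linarith), boolSign, if_pos rfl]

theorem signRemainder_half (up : Bool) {y : ℝ} (hy : y ∈ Set.Ico (-1 : ℝ) 1) :
    signRemainder ((y + boolSign up) / 2) 1 = y := by
  rw [signRemainder_succ, signDigit_half up hy, signRemainder]
  ring

/-- The factors `1`, `F`, `G` of the monomials. -/
noncomputable def stateFactor (lam z : ℂ) (s : Fin 3) (x : ℝ) : ℂ :=
  ![1, walkSeries lam z x, loopSeries lam z x] s

/-- The monomial `x^n y₁ ⋯ y_B`. -/
noncomputable def stateMonomial {A B : ℕ} (lam : ℂ) (z : Fin B → ℂ) (p : LoopState A B) (x : ℝ) :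
    ℂ :=
  (x : ℂ) ^ (p.1 : ℕ) * ∏ i, stateFactor lam (z i) (p.2 i) x

/-- The factor z clears the z⁻¹ of the lower branch, which leaves exponents 2 and 0 on F and 1 on
the other factors. -/
theorem stateFactor_half {lam z : ℂ} (h : ‖lam‖ < 1) (hz : ‖z‖ = 1) (s : Fin 3) (up : Bool)
    {y : ℝ} (hy : y ∈ Set.Ico (-1 : ℝ) 1) :
    z * stateFactor lam z s ((y + boolSign up) / 2) =
      ∑ s' : Fin 3, (if (s' : ℕ) = s ∨ (s' : ℕ) + 1 = s then
        (if s' ≠ 0 then lam else 1) * z ^ (if s' = 1 then (if up then 2 else 0) else 1) else 0)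
        * stateFactor lam z s' y := by
  have hz0 : z ≠ 0 := fun h0 => by simp [h0] at hz
  have hF := walkSeries_eq h hz ((y + boolSign up) / 2)
  have hG := loopSeries_eq h hz ((y + boolSign up) / 2)
  rw [signDigit_half up hy, signRemainder_half up hy] at hF hG
  have hs : z * z ^ boolSign up = z ^ (if up then 2 else 0) := by
    cases up
    · simp [boolSign, hz0]
    · simp [boolSign, pow_two]
  rw [Fin.sum_univ_three]
  fin_cases s
  · simp [stateFactor]
  · simp [stateFactor, hF, ← hs]
    ring
  · simp [stateFactor, hG, ← hs]
    ring

/-- `evalLamZ` as a ring homomorphism. -/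
noncomputable def evalLamZHom {B : ℕ} (lam : ℂ) (z : Fin B → ℂ) :
    MvPolynomial (Option (Fin B)) ℤ →+* ℂ :=
  (MvPolynomial.aeval fun o : Option (Fin B) => o.elim lam z).toRingHom

section
variable {A B : ℕ} (lam : ℂ) (z : Fin B → ℂ)

theorem evalLamZHom_apply (p : MvPolynomial (Option (Fin B)) ℤ) :
    evalLamZHom lam z p = evalLamZ lam z p := rfl

@[simp] theorem evalLamZHom_X_none : evalLamZHom lam z (MvPolynomial.X none) = lam := by
  simp [evalLamZHom]

@[simp] theorem evalLamZHom_X_some (i : Fin B) :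
    evalLamZHom lam z (MvPolynomial.X (some i)) = z i := by
  simp [evalLamZHom]

@[simp] theorem evalLamZHom_C (k : ℤ) : evalLamZHom lam z (MvPolynomial.C k) = k := by
  simp [evalLamZHom]

theorem evalLamZHom_stepScale :
    evalLamZHom lam z (stepScale A B) = 2 ^ (A + 1) * ∏ i, z i := by
  simp only [stepScale, map_mul, map_prod, evalLamZHom_X_some, evalLamZHom_C]
  push_cast
  rfl

theorem pow_weight (q : LoopState A B) :
    lam ^ q.weight = ∏ i, if q.2 i ≠ 0 then lam else 1 := by
  rw [Finset.prod_ite, Finset.prod_const, Finset.prod_const_one, mul_one, LoopState.weight]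

/-- The step matrix is a tensor product: one factor for the power of x and one for each i. The
substitution rule can thus be checked factor by factor. -/
theorem evalLamZHom_stepMatrix (up : Bool) (p q : LoopState A B) :
    evalLamZHom lam z (stepMatrix A B up p q) =
      (if q.1 ≤ p.1 then
        2 ^ (A - (p.1 : ℕ)) * ((p.1 : ℕ).choose q.1 : ℂ)
          * (boolSign up : ℂ) ^ ((p.1 : ℕ) - (q.1 : ℕ)) else 0) *
      ∏ i, (if (q.2 i : ℕ) = p.2 i ∨ (q.2 i : ℕ) + 1 = p.2 i then
        (if q.2 i ≠ 0 then lam else 1) * z i ^ (if q.2 i = 1 then (if up then 2 else 0) else 1)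
        else 0) := by
  rw [stepMatrix, Matrix.of_apply]
  by_cases h1 : q.1 ≤ p.1
  · by_cases h2 : ∀ i, (q.2 i : ℕ) = p.2 i ∨ (q.2 i : ℕ) + 1 = p.2 i
    · rw [if_pos ⟨h1, h2⟩, if_pos h1, Finset.prod_congr rfl fun i _ => if_pos (h2 i),
        Finset.prod_mul_distrib, ← pow_weight]
      simp only [map_mul, map_prod, map_pow, evalLamZHom_X_some, evalLamZHom_C, evalLamZHom_X_none]
      rw [show (if up then (1 : ℤ) else -1) = boolSign up from rfl]
      push_cast
      ring
    · rw [if_neg fun h => h2 h.2, map_zero]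
      push Not at h2
      obtain ⟨i, hi⟩ := h2
      rw [Finset.prod_eq_zero (Finset.mem_univ i), mul_zero]
      rw [if_neg (by tauto)]
  · rw [if_neg fun h => h1 h.1, if_neg h1, zero_mul, map_zero]

variable {lam z}

/-- The binomial theorem; 2^A is a common denominator for all n ≤ A. -/
theorem half_pow_eq_sum {A : ℕ} (n : Fin (A + 1)) (s y : ℂ) :
    2 ^ A * ((y + s) / 2) ^ (n : ℕ) = ∑ k : Fin (A + 1), (if k ≤ n then
        2 ^ (A - (n : ℕ)) * ((n : ℕ).choose k : ℂ) * s ^ ((n : ℕ) - (k : ℕ)) else 0)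
          * y ^ (k : ℕ) := by
  have hn : (n : ℕ) ≤ A := Nat.lt_succ_iff.1 n.2
  let g : ℕ → ℂ := fun j => if j ≤ n then 2 ^ (A - (n : ℕ)) *
    (y ^ j * s ^ ((n : ℕ) - j) * ((n : ℕ).choose j : ℂ)) else 0
  have h : ∀ k : Fin (A + 1), (if k ≤ n then
        2 ^ (A - (n : ℕ)) * ((n : ℕ).choose k : ℂ) * s ^ ((n : ℕ) - (k : ℕ)) else 0)
          * y ^ (k : ℕ) = g k := by
    intro k
    simp only [Fin.le_def, g]
    split_ifs <;> ring
  have h3 : (2 : ℂ) ^ A = 2 ^ (A - (n : ℕ)) * 2 ^ (n : ℕ) := by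
    rw [← pow_add, Nat.sub_add_cancel hn]
  rw [Finset.sum_congr rfl fun k _ => h k, Fin.sum_univ_eq_sum_range g, div_pow, add_pow,
    ← Finset.sum_subset (Finset.range_mono (Nat.succ_le_succ hn))]
  · rw [Finset.sum_congr rfl fun k hk => if_pos (Nat.lt_succ_iff.1 (Finset.mem_range.1 hk)),
      ← Finset.mul_sum, h3]
    field_simp
  · intro k _ hk
    exact if_neg fun h' => hk (Finset.mem_range.2 (Nat.lt_succ_of_le h'))

/-- The substitution rule for the monomials. -/
theorem stateMonomial_half (h : ‖lam‖ < 1) (hz : ∀ i, ‖z i‖ = 1) (p : LoopState A B) (up : Bool)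
    {y : ℝ} (hy : y ∈ Set.Ico (-1 : ℝ) 1) :
    2 ^ A * (∏ i, z i) * stateMonomial lam z p ((y + boolSign up) / 2) =
      ∑ q, evalLamZHom lam z (stepMatrix A B up p q) * stateMonomial lam z q y := by
  have h1 := half_pow_eq_sum p.1 (boolSign up : ℂ) (y : ℂ)
  have h2 := Finset.prod_mul_distrib.symm.trans
    (Finset.prod_congr (rfl : (Finset.univ : Finset (Fin B)) = Finset.univ)
      fun i _ => stateFactor_half h (hz i) (p.2 i) up hy)
  rw [Finset.prod_univ_sum, Fintype.piFinset_univ] at h2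
  rw [stateMonomial]
  push_cast
  rw [show ∀ a b c d : ℂ, a * b * (c * d) = (a * c) * (b * d) by intros; ring, h1, h2,
    Finset.sum_mul_sum, Fintype.sum_prod_type]
  refine Finset.sum_congr rfl fun k _ => Finset.sum_congr rfl fun s _ => ?_
  rw [evalLamZHom_stepMatrix, stateMonomial, Finset.prod_mul_distrib]
  ring

/-! ### Iterated substitution on dyadic intervals -/

/-- The affine map of `[-1, 1]` onto `[-1 + 2t/2^M, -1 + 2(t+1)/2^M]`. -/
noncomputable def dyadicMap (M t : ℕ) (y : ℝ) : ℝ := -1 + (2 * t + 1 + y) / 2 ^ M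

/-- The last binary digit of t selects the half taken innermost, so it is the last factor of the
word. -/
theorem dyadicMap_succ (M t : ℕ) (y : ℝ) :
    dyadicMap (M + 1) t y = dyadicMap M (t / 2) ((y + boolSign (decide (t % 2 = 1))) / 2) := by
  have ht : (t : ℝ) = 2 * (t / 2 : ℕ) + (t % 2 : ℕ) := by exact_mod_cast (Nat.div_add_mod t 2).symm
  rw [dyadicMap, dyadicMap, ht]
  rcases Nat.mod_two_eq_zero_or_one t with h | h
  · simp only [h, boolSign]
    norm_num
    field_simp
    ring
  · simp only [h, boolSign]
    norm_num
    field_simp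
    ring

theorem stateMonomial_dyadicMap (h : ‖lam‖ < 1) (hz : ∀ i, ‖z i‖ = 1) (M : ℕ) :
    ∀ (t : ℕ), t < 2 ^ M → ∀ (p : LoopState A B) {y : ℝ}, y ∈ Set.Ico (-1 : ℝ) 1 →
    (2 ^ A * ∏ i, z i) ^ M * stateMonomial lam z p (dyadicMap M t y) =
      ∑ q, evalLamZHom lam z (wordMatrix A B M t p q) * stateMonomial lam z q y := by
  induction M with
  | zero =>
    intro t ht p y hy
    have ht' : t = 0 := by simpa using ht
    simp [ht', wordMatrix, dyadicMap, Matrix.one_apply, apply_ite (evalLamZHom lam z)]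
  | succ M ih =>
    intro t ht p y hy
    have hy' : (y + boolSign (decide (t % 2 = 1))) / 2 ∈ Set.Ico (-1 : ℝ) 1 := by
      obtain ⟨h1, h2⟩ := hy
      rcases Nat.mod_two_eq_zero_or_one t with h | h <;> simp only [h, boolSign] <;>
        norm_num <;> constructor <;> linarith
    rw [dyadicMap_succ, pow_succ', mul_assoc, ih (t / 2) (by rw [pow_succ] at ht; omega) p hy',
      Finset.mul_sum]
    simp only [wordMatrix, Matrix.mul_apply, map_sum, map_mul, Finset.sum_mul]
    rw [Finset.sum_comm]
    refine Finset.sum_congr rfl fun q _ => ?_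
    rw [mul_left_comm, stateMonomial_half h hz q _ hy, Finset.mul_sum]
    exact Finset.sum_congr rfl fun r _ => by ring

end

/-! ### The determinant and the factorization of Q -/

section
variable {A B : ℕ}

/-- A matrix indexed by a partial order that vanishes unless `q ≤ p` has the product of its
diagonal as its determinant. -/
theorem Matrix.det_eq_prod_diag_of_le {ι R : Type*} [Fintype ι] [DecidableEq ι] [PartialOrder ι]
    [CommRing R] (M : Matrix ι ι R) (hM : ∀ p q, M p q ≠ 0 → q ≤ p) : M.det = ∏ p, M p p := by
  -- A linear extension makes the matrix lower triangular for a total order.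
  let e : ι ≃ LinearExtension ι := Equiv.refl ι
  let _ : Fintype (LinearExtension ι) := Fintype.ofEquiv ι e
  have h := Matrix.det_of_isLowerTriangular (M := M.submatrix e.symm e.symm) ?_
  · rw [Matrix.det_submatrix_equiv_self] at h
    rw [h]
    exact Fintype.prod_equiv e.symm _ _ fun _ => rfl
  · intro i j hij
    by_contra hne
    have h1 := toLinearExtension.monotone (hM _ _ hne)
    exact absurd h1 (not_le_of_gt hij)

theorem stepMatrix_ne_zero_le {up : Bool} {p q : LoopState A B}
    (h : stepMatrix A B up p q ≠ 0) : q ≤ p := by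
  rw [stepMatrix, Matrix.of_apply] at h
  obtain ⟨h1, h2⟩ := (ne_eq _ _ ▸ ite_ne_right_iff.1 h).1
  exact ⟨h1, fun i => Fin.le_def.2 (by have := h2 i; omega)⟩

theorem det_systemMatrix : (systemMatrix A B).det = ∏ p, systemMatrix A B p p := by
  refine Matrix.det_eq_prod_diag_of_le _ fun p q h => ?_
  by_contra hle
  apply h
  have hne : q ≠ p := fun h' => hle h'.le
  rw [systemMatrix, Matrix.of_apply]
  split_ifs
  · rfl
  · rw [not_ne_iff.1 (mt stepMatrix_ne_zero_le hle), not_ne_iff.1 (mt stepMatrix_ne_zero_le hle)]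
    simp

theorem systemMatrix_diag_zero : systemMatrix A B (0, fun _ => 0) (0, fun _ => 0) = 1 := by
  simp [systemMatrix]

/-- Here α is the set of i with y_i = F_i: only there do the two branches differ, contributing z_i²
and 1. Every other i gives a common factor z_i. -/
theorem systemMatrix_diag {p : LoopState A B} (hp : p ≠ (0, fun _ => 0)) :
    systemMatrix A B p p = MvPolynomial.C (-2 ^ (A - (p.1 : ℕ))) *
      (∏ i, MvPolynomial.X (some i) ^ (if p.2 i = 1 then 0 else 1)) *
      loopQuadratic (Finset.univ.filter fun i => p.2 i = 1) p.1 p.weight := by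
  have hA : (2 : ℤ) ^ (A + 1) = 2 ^ (A - (p.1 : ℕ)) * 2 ^ ((p.1 : ℕ) + 1) := by
    rw [← pow_add]
    congr 1
    omega
  have hprod : ∀ k : ℕ, (∏ i, (MvPolynomial.X (some i) : MvPolynomial (Option (Fin B)) ℤ)
        ^ (if p.2 i = 1 then k else 1)) =
      (∏ i ∈ Finset.univ.filter fun i => p.2 i = 1, MvPolynomial.X (some i) ^ k) *
        ∏ i, MvPolynomial.X (some i) ^ (if p.2 i = 1 then 0 else 1) := by
    intro k
    rw [Finset.prod_filter, ← Finset.prod_mul_distrib]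
    refine Finset.prod_congr rfl fun i _ => ?_
    split_ifs <;> simp
  have h1 : stepScale A B =
      MvPolynomial.C (2 ^ (A - (p.1 : ℕ)) * 2 ^ ((p.1 : ℕ) + 1)) * ∏ i,
      MvPolynomial.X (some i) ^ (if p.2 i = 1 then 1 else 1) := by
    simp [stepScale, ← hA]
  have hcond : p.1 ≤ p.1 ∧ ∀ i, (p.2 i : ℕ) = p.2 i ∨ (p.2 i : ℕ) + 1 = p.2 i :=
    ⟨le_rfl, fun _ => Or.inl rfl⟩
  rw [systemMatrix, Matrix.of_apply, if_neg hp, if_pos rfl, h1, hprod 1, stepMatrix, stepMatrix,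
    Matrix.of_apply, Matrix.of_apply, if_pos hcond, if_pos hcond]
  simp only [if_true, Bool.false_eq_true, if_false, hprod 2, loopQuadratic,
    Nat.choose_self, Nat.sub_self, pow_zero, pow_one, map_mul, map_pow, map_neg, Nat.cast_one, mul_one]
  ring

/-- The polynomials `a(λ) z₁^{e₁} ⋯ z_B^{e_B} ∏ q_k` with quadratics `q_k`. -/
def IsQuadraticProduct (A : ℕ) (p : MvPolynomial (Option (Fin B)) ℤ) : Prop :=
  ∃ (a : Polynomial ℤ) (e : Fin B → ℕ) (S : Multiset (Finset (Fin B) × ℕ × ℕ)),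
    (∀ t ∈ S, t.2.1 ≤ A ∧ t.2.2 ≤ B) ∧
    p = Polynomial.aeval (MvPolynomial.X none) a * (∏ i, MvPolynomial.X (some i) ^ e i) *
      (S.map fun t => loopQuadratic t.1 t.2.1 t.2.2).prod

theorem IsQuadraticProduct.C (k : ℤ) :
    IsQuadraticProduct (B := B) A (MvPolynomial.C k) :=
  ⟨Polynomial.C k, 0, 0, by simp, by simp⟩

theorem IsQuadraticProduct.one : IsQuadraticProduct (B := B) A 1 :=
  MvPolynomial.C_1 (R := ℤ) ▸ IsQuadraticProduct.C 1

theorem IsQuadraticProduct.prod_X_pow (e : Fin B → ℕ) :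
    IsQuadraticProduct A (∏ i, MvPolynomial.X (some i) ^ e i) :=
  ⟨1, e, 0, by simp, by simp⟩

theorem IsQuadraticProduct.loopQuadratic {α : Finset (Fin B)} {n m : ℕ} (hn : n ≤ A)
    (hm : m ≤ B) : IsQuadraticProduct A (loopQuadratic α n m) :=
  ⟨1, 0, {(α, n, m)}, by simp [hn, hm], by simp⟩

theorem IsQuadraticProduct.mul {p q : MvPolynomial (Option (Fin B)) ℤ}
    (hp : IsQuadraticProduct A p) (hq : IsQuadraticProduct A q) :
    IsQuadraticProduct A (p * q) := by
  obtain ⟨a, e, S, hS, rfl⟩ := hp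
  obtain ⟨b, f, T, hT, rfl⟩ := hq
  refine ⟨a * b, e + f, S + T, fun t ht => (Multiset.mem_add.1 ht).elim (hS t) (hT t), ?_⟩
  simp only [map_mul, Pi.add_apply, pow_add, Finset.prod_mul_distrib, Multiset.map_add,
    Multiset.prod_add]
  ring

theorem IsQuadraticProduct.pow {p : MvPolynomial (Option (Fin B)) ℤ}
    (hp : IsQuadraticProduct A p) (k : ℕ) : IsQuadraticProduct A (p ^ k) := by
  induction k with
  | zero => simpa using IsQuadraticProduct.one
  | succ k ih => rw [pow_succ]; exact ih.mul hp

theorem isQuadraticProduct_loopQ (N : ℕ) : IsQuadraticProduct A (loopQ A B N) := by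
  have hX : IsQuadraticProduct A (∏ i : Fin B, MvPolynomial.X (some i)) := by
    simpa using IsQuadraticProduct.prod_X_pow (A := A) (fun _ : Fin B => 1)
  refine IsQuadraticProduct.mul (IsQuadraticProduct.mul ?_
    (IsQuadraticProduct.pow ((IsQuadraticProduct.C _).mul hX) _)) hX
  rw [det_systemMatrix]
  refine Finset.prod_induction _ _ (fun _ _ => IsQuadraticProduct.mul) IsQuadraticProduct.one ?_
  intro p _
  by_cases hp : p = (0, fun _ => 0)
  · rw [hp, systemMatrix_diag_zero]
    exact IsQuadraticProduct.one
  · rw [systemMatrix_diag hp]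
    exact ((IsQuadraticProduct.C _).mul (IsQuadraticProduct.prod_X_pow _)).mul
      (IsQuadraticProduct.loopQuadratic (Nat.lt_succ_iff.1 p.1.2)
        ((Finset.card_filter_le _ _).trans (by simp)))

/-! ### Nonvanishing of Q on the torus -/

variable {lam : ℂ} {z : Fin B → ℂ}

theorem eval_loopQuadratic (α : Finset (Fin B)) (n m : ℕ) :
    evalLamZHom lam z (loopQuadratic α n m) =
      lam ^ m * ((∏ i ∈ α, z i) ^ 2 + 1) - 2 ^ (n + 1) * ∏ i ∈ α, z i := by
  simp only [loopQuadratic, map_add, map_sub, map_mul, map_prod, map_pow, evalLamZHom_X_some,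
    evalLamZHom_C, evalLamZHom_X_none, Finset.prod_pow]
  push_cast
  ring

/-- With u = ∏ z_i of modulus 1, a zero would force 2^{n+1} = |λ|^m |u² + 1| ≤ 2|λ|^m, which is
impossible for |λ| < 1 unless n = m = 0. -/
theorem eval_loopQuadratic_ne_zero (h : ‖lam‖ < 1) (hz : ∀ i, ‖z i‖ = 1) {α : Finset (Fin B)}
    {n m : ℕ} (hnm : n ≠ 0 ∨ m ≠ 0) : evalLamZHom lam z (loopQuadratic α n m) ≠ 0 := by
  rw [eval_loopQuadratic]
  set u := ∏ i ∈ α, z i with hu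
  have hu1 : ‖u‖ = 1 := by simp [hu, norm_prod, hz]
  intro h0
  have h1 : ‖lam‖ ^ m * ‖u ^ 2 + 1‖ = 2 ^ (n + 1) := by
    have := congrArg norm (sub_eq_zero.1 h0)
    simpa [hu1] using this
  have h2 : ‖u ^ 2 + 1‖ ≤ 2 := (norm_add_le _ _).trans (by simp [hu1]; norm_num)
  have h3 : ‖lam‖ ^ m ≤ 1 := pow_le_one₀ (norm_nonneg _) h.le
  have h4 : (1 : ℝ) ≤ 2 ^ n := one_le_pow₀ (by norm_num)
  have h5 : ‖lam‖ ^ m < 2 ^ n := by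
    rcases hnm with hn | hm
    · exact h3.trans_lt (one_lt_pow₀ (by norm_num) hn)
    · exact (pow_lt_one₀ (norm_nonneg _) h hm).trans_le h4
  have h6 : ‖lam‖ ^ m * ‖u ^ 2 + 1‖ ≤ ‖lam‖ ^ m * 2 := by gcongr
  rw [pow_succ (2 : ℝ)] at h1
  linarith

theorem eval_det_systemMatrix_ne_zero (h : ‖lam‖ < 1) (hz : ∀ i, ‖z i‖ = 1) :
    evalLamZHom lam z (systemMatrix A B).det ≠ 0 := by
  have hz0 : ∀ i, z i ≠ 0 := fun i h0 => by simpa [h0] using hz i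
  rw [det_systemMatrix, map_prod]
  refine Finset.prod_ne_zero_iff.2 fun p _ => ?_
  by_cases hp : p = (0, fun _ => 0)
  · rw [hp, systemMatrix_diag_zero, map_one]
    exact one_ne_zero
  · rw [systemMatrix_diag hp, map_mul, map_mul]
    refine mul_ne_zero (mul_ne_zero ?_ ?_) (eval_loopQuadratic_ne_zero h hz ?_)
    · rw [evalLamZHom_C]
      exact Int.cast_ne_zero.2 (neg_ne_zero.2 (by positivity))
    · rw [map_prod]
      refine Finset.prod_ne_zero_iff.2 fun i _ => ?_
      rw [map_pow, evalLamZHom_X_some]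
      exact pow_ne_zero _ (hz0 i)
    -- Only the monomial 1 has n = m = 0, and its row was replaced by a row of the identity.
    · by_contra! hc
      apply hp
      have h2 : p.2 = fun _ => 0 := by
        funext i
        by_contra hi
        have := Finset.card_eq_zero.1 hc.2
        exact Finset.notMem_empty i (this ▸ Finset.mem_filter.2 ⟨Finset.mem_univ i, hi⟩)
      exact Prod.ext (Fin.ext hc.1) h2

theorem eval_stepScale_ne_zero (hz : ∀ i, ‖z i‖ = 1) :
    evalLamZHom lam z (stepScale A B) ≠ 0 := by
  have hz0 : ∀ i, z i ≠ 0 := fun i h0 => by simpa [h0] using hz i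
  rw [evalLamZHom_stepScale]
  exact mul_ne_zero (pow_ne_zero _ two_ne_zero) (Finset.prod_ne_zero_iff.2 fun i _ => hz0 i)

theorem eval_loopQ (N : ℕ) : evalLamZ lam z (loopQ A B N) =
    evalLamZHom lam z (systemMatrix A B).det * evalLamZHom lam z (stepScale A B) ^ (N + 1)
      * ∏ i, z i := by
  rw [← evalLamZHom_apply, loopQ, map_mul, map_mul, map_pow, map_prod]
  simp only [evalLamZHom_X_some]

theorem eval_loopQ_ne_zero (h : ‖lam‖ < 1) (hz : ∀ i, ‖z i‖ = 1) (N : ℕ) :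
    evalLamZ lam z (loopQ A B N) ≠ 0 := by
  have hz0 : ∀ i, z i ≠ 0 := fun i h0 => by simpa [h0] using hz i
  rw [eval_loopQ]
  exact mul_ne_zero (mul_ne_zero (eval_det_systemMatrix_ne_zero h hz)
    (pow_ne_zero _ (eval_stepScale_ne_zero hz))) (Finset.prod_ne_zero_iff.2 fun i _ => hz0 i)

end

/-! ### Integrals of the monomials and the linear system -/

section
variable {A B : ℕ} {lam : ℂ}

theorem measurable_walkSeries (z : ℂ) : Measurable (walkSeries lam z) := by
  refine measurable_const.add (Measurable.tsum fun m => measurable_const.mul ?_)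
  exact (Measurable.of_discrete (f := fun k : ℤ => z ^ k)).comp (measurable_digitSum 0 m)

theorem measurable_loopSeries (z : ℂ) : Measurable (loopSeries lam z) := by
  refine Measurable.tsum fun m => Finset.measurable_sum _ fun n _ => measurable_const.mul ?_
  exact (Measurable.of_discrete (f := fun k : ℤ => z ^ k)).comp (measurable_digitSum n m)

theorem measurable_loopTerm_exp {α : Type*} [MeasurableSpace α] {θ x : α → ℝ} (hθ : Measurable θ)
    (hx : Measurable x) (m : ℕ) :
    Measurable fun a => loopTerm lam (Complex.exp (θ a * Complex.I)) (x a) m := by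
  refine Finset.measurable_sum _ fun n _ => measurable_const.mul ?_
  -- Writing the power as an exponential makes joint measurability in angle and exponent visible.
  simp only [← Complex.exp_int_mul]
  have h : Measurable fun a => ((digitSum n m (x a) : ℤ) : ℂ) :=
    (Measurable.of_discrete (f := fun k : ℤ => (k : ℂ))).comp ((measurable_digitSum n m).comp hx)
  exact Complex.measurable_exp.comp
    (h.mul ((Complex.measurable_ofReal.comp hθ).mul measurable_const))

theorem measurable_loopSeries_exp {α : Type*} [MeasurableSpace α] {θ x : α → ℝ}
    (hθ : Measurable θ) (hx : Measurable x) :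
    Measurable fun a => loopSeries lam (Complex.exp (θ a * Complex.I)) (x a) :=
  Measurable.tsum fun m => measurable_loopTerm_exp hθ hx m

theorem measurable_stateMonomial (z : Fin B → ℂ) (p : LoopState A B) :
    Measurable (stateMonomial lam z p) := by
  refine (Complex.measurable_ofReal.pow_const _).mul (Finset.measurable_prod _ fun i _ => ?_)
  generalize p.2 i = s
  fin_cases s
  · exact measurable_const
  · exact measurable_walkSeries _
  · exact measurable_loopSeries _

theorem exists_norm_stateFactor_le (h : ‖lam‖ < 1) :
    ∃ K : ℝ, ∀ z : ℂ, ‖z‖ = 1 → ∀ s x, ‖stateFactor lam z s x‖ ≤ K := by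
  refine ⟨max 1 (max (1 + ∑' m : ℕ, ‖lam‖ ^ (m + 1))
    (∑' m : ℕ, ((m + 1 : ℕ) : ℝ) * ‖lam‖ ^ (m + 1))), fun z hz s x => ?_⟩
  fin_cases s
  · simp [stateFactor]
  · exact (norm_walkSeries_le h hz x).trans ((le_max_left _ _).trans (le_max_right _ _))
  · exact (norm_loopSeries_le h hz x).trans ((le_max_right _ _).trans (le_max_right _ _))

/-- Uniformity in z as well as in x is what Fubini over the torus needs. -/
theorem exists_norm_stateMonomial_le (h : ‖lam‖ < 1) :
    ∃ K : ℝ, ∀ z : Fin B → ℂ, (∀ i, ‖z i‖ = 1) → ∀ (p : LoopState A B),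
      ∀ x ∈ Set.Icc (-1 : ℝ) 1, ‖stateMonomial lam z p x‖ ≤ K := by
  obtain ⟨K, hK⟩ := exists_norm_stateFactor_le h
  refine ⟨K ^ B, fun z hz p x hx => ?_⟩
  have h1 : ‖(x : ℂ) ^ (p.1 : ℕ)‖ ≤ 1 := by
    rw [norm_pow, Complex.norm_real]
    exact pow_le_one₀ (norm_nonneg _) (abs_le.2 hx)
  have h2 : ‖∏ i, stateFactor lam (z i) (p.2 i) x‖ ≤ K ^ B := by
    rw [norm_prod]
    refine (Finset.prod_le_prod (fun _ _ => norm_nonneg _)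
      fun i _ => hK (z i) (hz i) (p.2 i) x).trans ?_
    simp
  rw [stateMonomial, norm_mul]
  calc _ ≤ 1 * K ^ B := by gcongr
    _ = _ := one_mul _

theorem intervalIntegrable_stateMonomial (h : ‖lam‖ < 1) {z : Fin B → ℂ} (hz : ∀ i, ‖z i‖ = 1)
    (p : LoopState A B) {a b : ℝ} (ha : a ∈ Set.Icc (-1 : ℝ) 1) (hb : b ∈ Set.Icc (-1 : ℝ) 1) :
    IntervalIntegrable (stateMonomial lam z p) volume a b := by
  obtain ⟨K, hK⟩ := exists_norm_stateMonomial_le (A := A) (B := B) h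
  rw [intervalIntegrable_iff]
  refine Measure.integrableOn_of_bounded (M := K) (by simp)
    (measurable_stateMonomial z p).aestronglyMeasurable ?_
  refine (ae_restrict_iff' measurableSet_uIoc).2 (ae_of_all _ fun x hx => hK z hz p x ?_)
  exact Set.uIcc_subset_Icc ha hb (Set.uIoc_subset_uIcc hx)

theorem dyadicMap_mem {M t : ℕ} (ht : t < 2 ^ M) {y : ℝ} (hy : y ∈ Set.Icc (-1 : ℝ) 1) :
    dyadicMap M t y ∈ Set.Icc (-1 : ℝ) 1 := by
  obtain ⟨h1, h2⟩ := hy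
  have h3 : (t : ℝ) + 1 ≤ 2 ^ M := by exact_mod_cast ht
  have h0 : (0 : ℝ) < 2 ^ M := by positivity
  constructor
  · have : 0 ≤ (2 * t + 1 + y) / 2 ^ M := div_nonneg (by linarith [t.cast_nonneg (α := ℝ)]) h0.le
    rw [dyadicMap]; linarith
  · have : (2 * t + 1 + y) / 2 ^ M ≤ 2 := (div_le_iff₀ h0).2 (by linarith)
    rw [dyadicMap]; linarith

theorem integral_dyadicMap (f : ℝ → ℂ) (M t : ℕ) :
    2 ^ M * ∫ x in (dyadicMap M t (-1))..(dyadicMap M t 1), f x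
      = ∫ y in (-1 : ℝ)..1, f (dyadicMap M t y) := by
  have h0 : ((2 : ℝ) ^ M)⁻¹ ≠ 0 := by positivity
  have h1 : ∀ y, dyadicMap M t y = ((2 : ℝ) ^ M)⁻¹ * y + (-1 + (2 * t + 1) / 2 ^ M) := by
    intro y
    rw [dyadicMap]
    ring
  simp only [h1]
  rw [intervalIntegral.integral_comp_mul_add f h0, inv_inv, Complex.real_smul]
  push_cast
  rfl

/-- Each factor `stepScale` is 2 times the scale 2^A z_1⋯z_B of one substitution; the surplus 2^M
cancels the Jacobian of `dyadicMap`. -/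
theorem stepScale_pow_mul_integral (h : ‖lam‖ < 1) {z : Fin B → ℂ} (hz : ∀ i, ‖z i‖ = 1)
    {M t : ℕ} (ht : t < 2 ^ M) (p : LoopState A B) :
    evalLamZHom lam z (stepScale A B) ^ M *
        ∫ x in (dyadicMap M t (-1))..(dyadicMap M t 1), stateMonomial lam z p x
      = ∑ q, evalLamZHom lam z (wordMatrix A B M t p q) *
          ∫ y in (-1 : ℝ)..1, stateMonomial lam z q y := by
  rw [evalLamZHom_stepScale, pow_succ', mul_assoc 2, mul_pow, mul_right_comm, integral_dyadicMap,
    mul_comm, ← intervalIntegral.integral_const_mul]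
  simp only [← intervalIntegral.integral_const_mul]
  rw [← intervalIntegral.integral_finsetSum]
  · refine intervalIntegral.integral_congr_Ioo_of_le (by norm_num) fun y hy => ?_
    exact stateMonomial_dyadicMap h hz M t ht p (Set.Ioo_subset_Ico_self hy)
  · intro q _
    exact (intervalIntegrable_stateMonomial h hz q (by simp) (by simp)).const_mul _

/-- The integrals of the monomials solve the linear system. -/
theorem systemMatrix_mulVec_integral (h : ‖lam‖ < 1) {z : Fin B → ℂ} (hz : ∀ i, ‖z i‖ = 1) :
    ((systemMatrix A B).map (evalLamZHom lam z)).mulVec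
      (fun q => ∫ y in (-1 : ℝ)..1, stateMonomial lam z q y)
      = evalLamZHom lam z ∘ systemRhs A B := by
  funext p
  simp only [Matrix.mulVec, dotProduct, Matrix.map_apply, Function.comp_apply, systemRhs,
    systemMatrix, Matrix.of_apply]
  by_cases hp : p = (0, fun _ => 0)
  · simp only [if_pos hp, apply_ite (evalLamZHom lam z), map_one, map_zero, ite_mul, one_mul,
      zero_mul, Finset.sum_ite_eq', Finset.mem_univ, if_true]
    have h1 : ∀ y, stateMonomial lam z p y = 1 := by
      intro y
      simp [stateMonomial, hp, stateFactor]
    simp only [h1]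
    rw [map_ofNat]
    simp
    norm_num
  -- The words of length one belong to the halves [-1,0] and [0,1].
  · have h0 := stepScale_pow_mul_integral h hz (M := 1) (t := 0) (by norm_num) p
    have h1 := stepScale_pow_mul_integral h hz (M := 1) (t := 1) (by norm_num) p
    simp only [wordMatrix, one_mul, pow_one, Nat.zero_mod, Nat.one_mod, zero_ne_one,
      decide_true, decide_false, dyadicMap] at h0 h1
    norm_num at h0 h1
    have hadd := intervalIntegral.integral_add_adjacent_intervals
      (intervalIntegrable_stateMonomial h hz p (a := -1) (b := 0) (by simp) (by simp))
      (intervalIntegrable_stateMonomial h hz p (a := 0) (b := 1) (by simp) (by simp))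
    simp only [if_neg hp, map_sub, apply_ite (evalLamZHom lam z), map_zero, sub_mul, ite_mul,
      zero_mul, Finset.sum_sub_distrib, Finset.sum_ite_eq', Finset.mem_univ, if_true]
    rw [← h0, ← h1, ← hadd]
    ring

/-- Multiplying the system by the adjugate gives Cramer's rule without dividing by the determinant.
-/
theorem det_mul_integral (h : ‖lam‖ < 1) {z : Fin B → ℂ} (hz : ∀ i, ‖z i‖ = 1)
    (q : LoopState A B) :
    evalLamZHom lam z (systemMatrix A B).det * ∫ y in (-1 : ℝ)..1, stateMonomial lam z q y
      = evalLamZHom lam z ((systemMatrix A B).cramer (systemRhs A B) q) := by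
  rw [Matrix.cramer_eq_adjugate_mulVec, RingHom.map_mulVec, ← systemMatrix_mulVec_integral h hz,
    RingHom.map_det, ← RingHom.mapMatrix_apply, ← RingHom.mapMatrix_apply, RingHom.map_adjugate,
    Matrix.mulVec_mulVec, Matrix.adjugate_mul, Matrix.smul_mulVec, Matrix.one_mulVec]
  rfl

theorem eval_loopP_div_loopQ (h : ‖lam‖ < 1) {z : Fin B → ℂ} (hz : ∀ i, ‖z i‖ = 1) {N : ℕ} {c : ℤ}
    (hc : |c| < 2 ^ N) :
    (∏ i, z i) * (evalLamZ lam z (loopP A B N c) / evalLamZ lam z (loopQ A B N)) =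
      ∫ x in (((c : ℝ) - 1) / 2 ^ N)..(((c : ℝ) + 1) / 2 ^ N),
        (x : ℂ) ^ A * ∏ i, loopSeries lam (z i) x := by
  have hz0 : ∀ i, z i ≠ 0 := fun i h0 => by simpa [h0] using hz i
  obtain ⟨hc1, hc2⟩ := abs_lt.1 hc
  -- At level N + 1 the dyadic intervals have length 1/2^N, and those numbered t and t + 1 are the
  -- two halves of the given interval. Since |c| < 2^N, `toNat` truncates nothing.
  obtain ⟨t, ht⟩ : ∃ t : ℕ, (t : ℤ) = c + 2 ^ N - 1 := ⟨(c + 2 ^ N - 1).toNat, by omega⟩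
  have hpow : ((2 ^ N : ℕ) : ℤ) = 2 ^ N := by push_cast; rfl
  have ht1 : t + 1 < 2 ^ (N + 1) := by rw [pow_succ]; omega
  have hcR : (t : ℝ) = c + 2 ^ N - 1 := by exact_mod_cast ht
  have e1 : (c + 2 ^ N - 1).toNat = t := by omega
  have e2 : (c + 2 ^ N).toNat = t + 1 := by omega
  let p : LoopState A B := (Fin.last A, fun _ => 2)
  have i1 := stepScale_pow_mul_integral h hz (Nat.lt_of_succ_lt ht1) p
  have i2 := stepScale_pow_mul_integral h hz ht1 p
  have b1 : dyadicMap (N + 1) t (-1) = ((c : ℝ) - 1) / 2 ^ N := by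
    rw [dyadicMap, hcR]; field_simp; ring
  have b2 : dyadicMap (N + 1) t 1 = (c : ℝ) / 2 ^ N := by
    rw [dyadicMap, hcR]; field_simp; ring
  have b3 : dyadicMap (N + 1) (t + 1) (-1) = (c : ℝ) / 2 ^ N := by
    rw [dyadicMap]; push_cast; rw [hcR]; field_simp; ring
  have b4 : dyadicMap (N + 1) (t + 1) 1 = ((c : ℝ) + 1) / 2 ^ N := by
    rw [dyadicMap]; push_cast; rw [hcR]; field_simp; ring
  have m1 := dyadicMap_mem (Nat.lt_of_succ_lt ht1) (y := -1) (by simp)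
  have m2 := dyadicMap_mem (Nat.lt_of_succ_lt ht1) (y := 1) (by simp)
  have m4 := dyadicMap_mem ht1 (y := 1) (by simp)
  rw [b1] at m1
  rw [b2] at m2
  rw [b4] at m4
  rw [b1, b2] at i1
  rw [b3, b4] at i2
  have hadd := intervalIntegral.integral_add_adjacent_intervals
    (intervalIntegrable_stateMonomial h hz p m1 m2) (intervalIntegrable_stateMonomial h hz p m2 m4)
  have hP : evalLamZ lam z (loopP A B N c) = evalLamZHom lam z (systemMatrix A B).det *
      (evalLamZHom lam z (stepScale A B) ^ (N + 1) *
        ∫ x in (((c : ℝ) - 1) / 2 ^ N)..(((c : ℝ) + 1) / 2 ^ N), stateMonomial lam z p x) := by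
    rw [← hadd, mul_add, i1, i2, ← evalLamZHom_apply, loopP, e1, e2, ← Finset.sum_add_distrib,
      Finset.mul_sum]
    simp only [Matrix.mulVec, dotProduct, map_sum, map_mul, Matrix.add_apply, map_add,
      ← det_mul_integral h hz]
    exact Finset.sum_congr rfl fun q _ => by ring
  have hd := eval_det_systemMatrix_ne_zero (A := A) h hz
  have hs := eval_stepScale_ne_zero (A := A) (lam := lam) hz
  have hprod : ∏ i, z i ≠ 0 := Finset.prod_ne_zero_iff.2 fun i _ => hz0 i
  have hmon : ∀ x : ℝ, stateMonomial lam z p x = (x : ℂ) ^ A * ∏ i, loopSeries lam (z i) x := by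
    intro x
    simp [stateMonomial, p, stateFactor]
  rw [hP, eval_loopQ]
  simp only [hmon]
  field_simp

end

/-! ### Extraction of constant terms and Fubini -/

section
variable {A B : ℕ} {lam : ℂ}

theorem integral_exp_zpow (k : ℤ) :
    ∫ θ in Set.Icc (0 : ℝ) (2 * Real.pi), Complex.exp (θ * Complex.I) ^ k
      = if k = 0 then 2 * (Real.pi : ℂ) else 0 := by
  rw [integral_Icc_eq_integral_Ioc, ← intervalIntegral.integral_of_le (by positivity)]
  split_ifs with hk
  · simp [hk]
  · have h1 : ∀ θ : ℝ, Complex.exp (θ * Complex.I) ^ k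
        = Complex.exp ((k * Complex.I) * θ) := by
      intro θ
      rw [← Complex.exp_int_mul]
      congr 1
      ring
    have h2 : (k * Complex.I) * ((2 * Real.pi : ℝ) : ℂ) = k * (2 * Real.pi * Complex.I) := by
      push_cast
      ring
    simp only [h1]
    rw [integral_exp_mul_complex (by simp [hk]), h2, Complex.exp_int_mul_two_pi_mul_I]
    simp

theorem integral_loopTerm (x : ℝ) (m : ℕ) :
    ∫ θ in Set.Icc (0 : ℝ) (2 * Real.pi), loopTerm lam (Complex.exp (θ * Complex.I)) x m
      = 2 * Real.pi * ∑ n ∈ Finset.range (m + 1), lam ^ (m + 1) * loopIndicator x n m := by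
  simp only [loopTerm]
  rw [integral_finsetSum, Finset.mul_sum]
  · refine Finset.sum_congr rfl fun n _ => ?_
    rw [integral_const_mul, integral_exp_zpow, loopIndicator, digitSum]
    split_ifs <;> ring
  · intro n _
    refine ContinuousOn.integrableOn_compact isCompact_Icc (Continuous.continuousOn ?_)
    simp only [← Complex.exp_int_mul]
    fun_prop

/-- The loop counting function is the constant term of `loopSeries`. -/
theorem integral_loopSeries (h : ‖lam‖ < 1) (x : ℝ) :
    ∫ θ in Set.Icc (0 : ℝ) (2 * Real.pi), loopSeries lam (Complex.exp (θ * Complex.I)) x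
      = 2 * Real.pi * loopU lam x := by
  have hs := hasSum_integral_of_dominated_convergence
    (μ := volume.restrict (Set.Icc (0 : ℝ) (2 * Real.pi)))
    (F := fun m θ => loopTerm lam (Complex.exp (θ * Complex.I)) x m)
    (f := fun θ => loopSeries lam (Complex.exp (θ * Complex.I)) x)
    (fun m _ => ((m + 1 : ℕ) : ℝ) * ‖lam‖ ^ (m + 1))
    (fun m => (measurable_loopTerm_exp measurable_id measurable_const m).aestronglyMeasurable)
    (fun m => ae_of_all _ fun θ => norm_loopTerm_le (Complex.norm_exp_ofReal_mul_I θ) x m)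
    (ae_of_all _ fun _ => summable_mul_norm_pow_succ h) (integrable_const _)
    (ae_of_all _ fun θ => (summable_loopTerm h (Complex.norm_exp_ofReal_mul_I θ) x).hasSum)
  rw [← hs.tsum_eq, loopU, ← tsum_mul_left]
  exact tsum_congr fun m => integral_loopTerm x m

/-- A separate angle for each factor turns the integral of the product into a product of equal
integrals. -/
theorem integral_prod_loopSeries (h : ‖lam‖ < 1) (x : ℝ) :
    ∫ θ in Set.Icc (0 : Fin B → ℝ) (fun _ => 2 * Real.pi),
      ∏ i, loopSeries lam (Complex.exp (θ i * Complex.I)) x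
      = (2 * Real.pi * loopU lam x) ^ B := by
  rw [← Set.pi_univ_Icc, volume_pi, Measure.restrict_pi_pi,
    integral_fintype_prod_eq_prod
      (f := fun _ (θ : ℝ) => loopSeries lam (Complex.exp (θ * Complex.I)) x)]
  simp only [Pi.zero_apply, integral_loopSeries h, Finset.prod_const, Finset.card_univ,
    Fintype.card_fin]

theorem integrable_uncurry_loopSeries (h : ‖lam‖ < 1) {a b : ℝ} (ha : -1 ≤ a) (hb : b ≤ 1) :
    Integrable (Function.uncurry fun (x : ℝ) (θ : Fin B → ℝ) =>
      (x : ℂ) ^ A * ∏ i, loopSeries lam (Complex.exp (θ i * Complex.I)) x)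
      ((volume.restrict (Set.Ioc a b)).prod
        (volume.restrict (Set.Icc (0 : Fin B → ℝ) (fun _ => 2 * Real.pi)))) := by
  obtain ⟨K, hK⟩ := exists_norm_stateMonomial_le (A := A) (B := B) h
  have : IsFiniteMeasure (volume.restrict (Set.Icc (0 : Fin B → ℝ) (fun _ => 2 * Real.pi))) :=
    isFiniteMeasure_restrict.2 isCompact_Icc.measure_lt_top.ne
  refine Integrable.of_bound (C := K) ?_ ?_
  · refine Measurable.aestronglyMeasurable ?_
    refine ((Complex.measurable_ofReal.comp measurable_fst).pow_const A).mul
      (Finset.measurable_prod _ fun i _ => ?_)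
    exact measurable_loopSeries_exp ((measurable_pi_apply i).comp measurable_snd) measurable_fst
  · rw [Measure.prod_restrict]
    refine (ae_restrict_iff' (measurableSet_Ioc.prod measurableSet_Icc)).2
      (ae_of_all _ fun q hq => ?_)
    have := hK (fun i => Complex.exp (q.2 i * Complex.I))
      (fun i => Complex.norm_exp_ofReal_mul_I _) (Fin.last A, fun _ => 2) q.1
      ⟨ha.trans hq.1.1.le, hq.1.2.trans hb⟩
    simpa [stateMonomial, stateFactor, Function.uncurry] using this

theorem interval_bounds {N : ℕ} {c : ℤ} (hc : |c| < 2 ^ N) :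
    -1 ≤ ((c : ℝ) - 1) / 2 ^ N ∧ ((c : ℝ) - 1) / 2 ^ N ≤ ((c : ℝ) + 1) / 2 ^ N ∧
      ((c : ℝ) + 1) / 2 ^ N ≤ 1 := by
  obtain ⟨h1, h2⟩ := abs_lt.1 hc
  have h1' : -(2 : ℝ) ^ N + 1 ≤ c := by exact_mod_cast h1
  have h2' : (c : ℝ) + 1 ≤ 2 ^ N := by exact_mod_cast h2
  have h0 : (0 : ℝ) < 2 ^ N := by positivity
  refine ⟨(le_div_iff₀ h0).2 (by linarith), by gcongr; linarith, (div_le_one h0).2 h2'⟩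

/-- Up to the constant (2π)^B the function is a partial integral of one that is integrable on the
product, hence integrable by Fubini. -/
theorem intervalIntegrable_loopU (h : ‖lam‖ < 1) {a b : ℝ} (ha : -1 ≤ a) (hab : a ≤ b)
    (hb : b ≤ 1) :
    IntervalIntegrable (fun x : ℝ => (x : ℂ) ^ A * loopU lam x ^ B) volume a b := by
  rw [intervalIntegrable_iff_integrableOn_Ioc_of_le hab]
  have hi := (integrable_uncurry_loopSeries (A := A) (B := B) h ha hb).integral_prod_left
  simp only [Function.uncurry_apply_pair, integral_const_mul, integral_prod_loopSeries h] at hi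
  have h0 : (2 * (Real.pi : ℂ)) ^ B ≠ 0 := pow_ne_zero _ (by simp [Real.pi_ne_zero])
  refine (hi.const_mul ((2 * (Real.pi : ℂ)) ^ B)⁻¹).congr (ae_of_all _ fun x => ?_)
  simp only [mul_pow (2 * (Real.pi : ℂ))]
  field_simp

theorem torusIntegral_loopP_div_loopQ (h : ‖lam‖ < 1) {N : ℕ} {c : ℤ} (hc : |c| < 2 ^ N) :
    torusIntegral (fun z : Fin B → ℂ =>
      evalLamZ lam z (loopP A B N c) / evalLamZ lam z (loopQ A B N)) 0 1
    = (2 * Real.pi * Complex.I) ^ B *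
      ∫ x in (((c : ℝ) - 1) / 2 ^ N)..(((c : ℝ) + 1) / 2 ^ N),
        (x : ℂ) ^ A * loopU lam x ^ B := by
  obtain ⟨ha, hab, hb⟩ := interval_bounds hc
  -- The factors e^{iθ_i} of dz_i supply the product ∏ z_i in `eval_loopP_div_loopQ`; what remains
  -- of the differential is I^B.
  have hint : ∀ θ : Fin B → ℝ, (∏ i, ((1 : Fin B → ℝ) i : ℂ) * Complex.exp (θ i * Complex.I)
        * Complex.I) • (evalLamZ lam (torusMap 0 1 θ) (loopP A B N c)
          / evalLamZ lam (torusMap 0 1 θ) (loopQ A B N))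
      = Complex.I ^ B * ∫ x in Set.Ioc (((c : ℝ) - 1) / 2 ^ N) (((c : ℝ) + 1) / 2 ^ N),
        (x : ℂ) ^ A * ∏ i, loopSeries lam (Complex.exp (θ i * Complex.I)) x := by
    intro θ
    have hmap : torusMap (0 : Fin B → ℂ) 1 θ = fun i => Complex.exp (θ i * Complex.I) := by
      funext i
      simp [torusMap]
    rw [hmap, ← intervalIntegral.integral_of_le hab, ← eval_loopP_div_loopQ h
      (fun i => Complex.norm_exp_ofReal_mul_I (θ i)) hc]
    simp [Finset.prod_mul_distrib]
    ring
  rw [torusIntegral]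
  simp only [hint]
  rw [integral_const_mul, ← integral_integral_swap (integrable_uncurry_loopSeries h ha hb),
    intervalIntegral.integral_of_le hab]
  simp only [integral_const_mul, integral_prod_loopSeries h]
  rw [mul_pow, mul_comm _ (Complex.I ^ B), mul_assoc]
  simp only [← integral_const_mul]
  refine integral_congr_ae (ae_of_all _ fun x => ?_)
  beta_reduce
  rw [mul_pow (2 * (Real.pi : ℂ))]
  ring

end

theorem theorem1 (A B N : ℕ) (c : ℤ) (hc : |c| < 2 ^ N) :
    (∃ (a : Polynomial ℤ) (e : Fin B → ℕ) (S : Multiset (Finset (Fin B) × ℕ × ℕ)),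
      (∀ t ∈ S, t.2.1 ≤ A ∧ t.2.2 ≤ B) ∧
      loopQ A B N = Polynomial.aeval (MvPolynomial.X none) a *
        (∏ i, MvPolynomial.X (some i) ^ e i) *
        (S.map fun t => loopQuadratic t.1 t.2.1 t.2.2).prod) ∧
    ∀ lam : ℂ, ‖lam‖ < 1 →
      (∀ z : Fin B → ℂ, (∀ i, ‖z i‖ = 1) → evalLamZ lam z (loopQ A B N) ≠ 0) ∧
      IntervalIntegrable (fun x : ℝ => (x : ℂ) ^ A * loopU lam x ^ B) volume
        (((c : ℝ) - 1) / 2 ^ N) (((c : ℝ) + 1) / 2 ^ N) ∧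
      ∫ x in (((c : ℝ) - 1) / 2 ^ N)..(((c : ℝ) + 1) / 2 ^ N), (x : ℂ) ^ A * loopU lam x ^ B =
        1 / (2 * (Real.pi : ℂ) * Complex.I) ^ B *
          torusIntegral (fun z : Fin B → ℂ =>
            evalLamZ lam z (loopP A B N c) / evalLamZ lam z (loopQ A B N)) 0 1 := by
  refine ⟨isQuadraticProduct_loopQ N, fun lam h => ⟨fun z hz => eval_loopQ_ne_zero h hz N, ?_, ?_⟩⟩
  · obtain ⟨ha, hab, hb⟩ := interval_bounds hc
    exact intervalIntegrable_loopU h ha hab hb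
  · have h0 : (2 * (Real.pi : ℂ) * Complex.I) ^ B ≠ 0 := pow_ne_zero _ Complex.two_pi_I_ne_zero
    rw [torusIntegral_loopP_div_loopQ h hc, ← mul_assoc, one_div, inv_mul_cancel₀ h0, one_mul]
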